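/- For integers $n\ge 2$, $k\ge 0$ let $h_k^n$ be the dimension of the space of harmonic homogeneous polynomials of degree $k$ in $n$ real variables. Let $P_k^n\in\mathbb{R}[t]$ be the Chebyshev polynomial $T_k$ if $n=2$, and $P_k^n(t)=C_k^{n/2-1}(t)/C_k^{n/2-1}(1)$ if $n\ge 3$, where $C^\lambda_0=1$, $C^\lambda_1=2\lambda t$ and $kC^\lambda_k=2(k+\lambda-1)tC^\lambda_{k-1}-(k+2\lambda-2)C^\lambda_{k-2}$ for $k\ge 2$. Put $\omega_n=2\pi^{n/2}/\Gamma(n/2)$. For $n\ge 3$ and $i,j,k\ge 0$ define polynomials in $u,v,t$ by $$Q_k^{n-1}(u,v,t)=\big((1-u^2)(1-v^2)\big)^{k/2}P_k^{n-1}\Big(\frac{t-uv}{\sqrt{(1-u^2)(1-v^2)}}\Big),$$ $$(Y_k^n)_{i,j}(u,v,t)=\lambda_{i,j}\,P_i^{n+2k}(u)\,P_j^{n+2k}(v)\,Q_k^{n-1}(u,v,t),\qquad \lambda_{i,j}=\frac{\omega_n}{\omega_{n-1}}\frac{\omega_{n+2k-1}}{\omega_{n+2k}}\big(h_i^{n+2k}h_j^{n+2k}\big)^{1/2},$$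 and let $S_k^n=\frac16\sum_\sigma\sigma Y_k^n$, where $\sigma$ runs over all permutations of the variables $u,v,t$. For $d\ge k$ the matrices $Y_k^n$, $S_k^n$ are cut to rows and columns $0\le i,j\le d-k$. **Proposition 3.6.** Let $n\ge 3$. For every $k\ge 0$ one has the identity in $\mathbb{R}[u,v,t]$ $$P_k^n(t)=\sum_{s=0}^k\frac{h_s^{n-1}}{h_k^n}\,(Y_s^n)_{k-s,k-s}(u,v,t).$$ Consequently, each of the following matrix-type positivity properties implies the classical one. Let $d\ge 0$ and let $C$ be a finite subset of the unit sphere $S^{n-1}\subset\mathbb{R}^n$. 1. If, for some $e\in S^{n-1}$, the matrix $\sum_{(c,c')\in C^2}Y_k^n(e\cdot c,e\cdot c',c\cdot c')$ is positive semidefinite for all $0\le k\le d$, then $\sum_{(c,c')\in C^2}P_k^n(c\cdot c')\ge 0$ for all $0\le k\le d$. 2. If the matrix $\sum_{(c,c',c'')\in C^3}S_k^n(c\cdot c',c\cdot c'',c'\cdot c'')$ is positive semidefinite for all $0\le k\le d$, then $\sum_{(c,c')\in C^2}P_k^n(c\cdot c')\ge 0$ for all $0\le k\le d$. -/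

import Mathlib

namespace SphereCode

/-- The surface area `2 π^(n/2) / Γ(n/2)` of the unit sphere of `ℝⁿ`. -/
noncomputable def sphereArea (n : ℕ) : ℝ :=
  2 * Real.pi ^ ((n : ℝ) / 2) / Real.Gamma ((n : ℝ) / 2)

/-- The Laplace operator on real polynomials in `n` variables. -/
noncomputable def laplacian (n : ℕ) :
    MvPolynomial (Fin n) ℝ →ₗ[ℝ] MvPolynomial (Fin n) ℝ :=
  ∑ i : Fin n, ((MvPolynomial.pderiv i : Derivation ℝ (MvPolynomial (Fin n) ℝ)
      (MvPolynomial (Fin n) ℝ)) : MvPolynomial (Fin n) ℝ →ₗ[ℝ] MvPolynomial (Fin n) ℝ) ∘ₗ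
    ((MvPolynomial.pderiv i : Derivation ℝ (MvPolynomial (Fin n) ℝ)
      (MvPolynomial (Fin n) ℝ)) : MvPolynomial (Fin n) ℝ →ₗ[ℝ] MvPolynomial (Fin n) ℝ)

/-- The space of harmonic polynomials in `n` variables that are homogeneous of degree `k`. -/
noncomputable def Harm (n k : ℕ) : Submodule ℝ (MvPolynomial (Fin n) ℝ) :=
  MvPolynomial.homogeneousSubmodule (Fin n) ℝ k ⊓ LinearMap.ker (laplacian n)

/-- The dimension `h_k^n` of `Harm n k`. -/
noncomputable def h (n k : ℕ) : ℕ := Module.finrank ℝ (Harm n k)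

/-- The Gegenbauer polynomials `C_k^lam`, by their three term recurrence
`k C_k = 2 (k + lam - 1) t C_{k-1} - (k + 2 lam - 2) C_{k-2}`. -/
noncomputable def gegenbauer (lam : ℝ) : ℕ → Polynomial ℝ
  | 0 => 1
  | 1 => Polynomial.C (2 * lam) * Polynomial.X
  | k + 2 => Polynomial.C ((k : ℝ) + 2)⁻¹ *
      (Polynomial.C (2 * ((k : ℝ) + 2 + lam - 1)) * Polynomial.X * gegenbauer lam (k + 1)
        - Polynomial.C ((k : ℝ) + 2 + 2 * lam - 2) * gegenbauer lam k)

/-- The zonal polynomial `P_k^n` of the unit sphere of `ℝⁿ`, of degree `k`, with value `1` at `1`: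
the Chebyshev polynomial `T_k` for `n = 2`, the normalized Gegenbauer polynomial with parameter
`n/2 - 1` for `n ≥ 3` (the values `n ≤ 1` are not used). -/
noncomputable def P (n k : ℕ) : Polynomial ℝ :=
  if n = 2 then Polynomial.Chebyshev.T ℝ (k : ℤ)
  else Polynomial.C ((gegenbauer ((n : ℝ) / 2 - 1) k).eval 1)⁻¹ *
    gegenbauer ((n : ℝ) / 2 - 1) k

theorem coeff_eq_zero_of_rec (p : ℕ → Polynomial ℝ) (a b : ℕ → ℝ) (c : ℝ) (h0 : p 0 = 1)
    (h1 : p 1 = Polynomial.C c * Polynomial.X)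
    (h2 : ∀ k, p (k + 2) =
      Polynomial.C (a k) * Polynomial.X * p (k + 1) - Polynomial.C (b k) * p k) :
    ∀ k j, (k < j ∨ Odd (k + j)) → (p k).coeff j = 0
  | 0, j, hj => by
      rw [h0, Polynomial.coeff_one, if_neg]
      rintro rfl
      simp at hj
  | 1, j, hj => by
      rw [h1, Polynomial.coeff_C_mul, Polynomial.coeff_X, if_neg, mul_zero]
      rintro rfl
      rcases hj with hj | hj
      · omega
      · exact absurd hj (by decide)
  | k + 2, j, hj => by
      have hk : (p k).coeff j = 0 := by
        apply coeff_eq_zero_of_rec p a b c h0 h1 h2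
        rcases hj with hj | hj
        · left; omega
        · right; grind
      rw [h2, Polynomial.coeff_sub, mul_assoc, Polynomial.coeff_C_mul, Polynomial.coeff_C_mul, hk]
      rcases j with _ | j
      · simp
      · have : (p (k + 1)).coeff j = 0 := by
          apply coeff_eq_zero_of_rec p a b c h0 h1 h2
          rcases hj with hj | hj
          · left; omega
          · right; grind
        rw [Polynomial.coeff_X_mul, this]
        simp

theorem P_coeff_eq_zero (m k j : ℕ) (hj : k < j ∨ Odd (k + j)) : (P m k).coeff j = 0 := by
  unfold P
  split_ifs
  · refine coeff_eq_zero_of_rec (fun k => Polynomial.Chebyshev.T ℝ (k : ℤ)) (fun _ => 2)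
      (fun _ => 1) 1 (by simp) (by simp) (fun k => ?_) k j hj
    have := Polynomial.Chebyshev.T_add_two ℝ (k : ℤ)
    push_cast
    rw [this]
    simp only [Polynomial.C_1, one_mul, map_ofNat]
  · rw [Polynomial.coeff_C_mul]
    rw [coeff_eq_zero_of_rec (gegenbauer ((m : ℝ) / 2 - 1))
      (fun k => ((k : ℝ) + 2)⁻¹ * (2 * ((k : ℝ) + 2 + ((m : ℝ) / 2 - 1) - 1)))
      (fun k => ((k : ℝ) + 2)⁻¹ * ((k : ℝ) + 2 + 2 * ((m : ℝ) / 2 - 1) - 2))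
      (2 * ((m : ℝ) / 2 - 1)) (by simp [gegenbauer]) (by simp only [gegenbauer])
      (fun k => ?_) k j hj, mul_zero]
    rw [gegenbauer]
    simp only [Polynomial.C_mul]
    ring

/-- The first of the three variables `u`, `v`, `t`. -/
noncomputable def U : MvPolynomial (Fin 3) ℝ := MvPolynomial.X 0
/-- The second variable. -/
noncomputable def V : MvPolynomial (Fin 3) ℝ := MvPolynomial.X 1
/-- The third variable. -/
noncomputable def T : MvPolynomial (Fin 3) ℝ := MvPolynomial.X 2

/-- The polynomial
`Q_k^m(u,v,t) = ((1-u²)(1-v²))^(k/2) P_k^m((t-uv)/√((1-u²)(1-v²)))`.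
As `P_k^m` has the parity of `k`, only the `j` with `k - j` even contribute to the sum, and the
division `(k - j) / 2` is exact for them; see `Q_eval`. -/
noncomputable def Q (m k : ℕ) : MvPolynomial (Fin 3) ℝ :=
  ∑ j ∈ Finset.range (k + 1), MvPolynomial.C ((P m k).coeff j) *
    (T - U * V) ^ j * ((1 - U ^ 2) * (1 - V ^ 2)) ^ ((k - j) / 2)

/-- `Q` is given by the formula in its description wherever that formula makes sense. -/
theorem Q_eval (m k : ℕ) (u v t : ℝ) (hu : u ^ 2 < 1) (hv : v ^ 2 < 1) :
    MvPolynomial.eval ![u, v, t] (Q m k) =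
      Real.sqrt ((1 - u ^ 2) * (1 - v ^ 2)) ^ k *
        (P m k).eval ((t - u * v) / Real.sqrt ((1 - u ^ 2) * (1 - v ^ 2))) := by
  have hw : 0 < (1 - u ^ 2) * (1 - v ^ 2) := mul_pos (by linarith) (by linarith)
  have hr := Real.sqrt_pos.2 hw
  have hsq := Real.sq_sqrt hw.le
  have hdeg : (P m k).natDegree < k + 1 := Nat.lt_succ_of_le
    (Polynomial.natDegree_le_iff_coeff_eq_zero.2 fun j hj => P_coeff_eq_zero m k j (Or.inl hj))
  rw [Polynomial.eval_eq_sum_range' hdeg, Finset.mul_sum, Q, map_sum]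
  refine Finset.sum_congr rfl fun j hj => ?_
  have hjk : j ≤ k := Nat.lt_succ_iff.1 (Finset.mem_range.1 hj)
  simp only [map_mul, map_pow, map_sub, MvPolynomial.eval_C, map_one, U, V, T,
    MvPolynomial.eval_X, Matrix.cons_val]
  rcases Nat.even_or_odd (k + j) with he | ho
  · obtain ⟨i, hi⟩ : ∃ i, k = j + 2 * i := ⟨(k - j) / 2, by grind⟩
    have h2 : (k - j) / 2 = i := by omega
    rw [h2]
    nth_rewrite 1 [← hsq]
    rw [hi, div_pow, ← pow_mul, pow_add]
    field_simp
  · rw [P_coeff_eq_zero m k j (Or.inr ho)]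
    simp

/-- The constant `λ_{i,j}` (it depends on `n` and `k` too). -/
noncomputable def lam (n k i j : ℕ) : ℝ :=
  sphereArea n / sphereArea (n - 1) * (sphereArea (n + 2 * k - 1) / sphereArea (n + 2 * k)) *
    Real.sqrt ((h (n + 2 * k) i : ℝ) * (h (n + 2 * k) j : ℝ))

/-- The matrix `Y_k^n`, as a matrix of infinite size with entries in `ℝ[u,v,t]`. -/
noncomputable def Y (n k : ℕ) : Matrix ℕ ℕ (MvPolynomial (Fin 3) ℝ) :=
  Matrix.of fun i j => MvPolynomial.C (lam n k i j) *
    Polynomial.aeval U (P (n + 2 * k) i) * Polynomial.aeval V (P (n + 2 * k) j) * Q (n - 1) k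

/-- The symmetrization `S_k^n` of `Y_k^n` under the permutations of the variables `u`, `v`, `t`. -/
noncomputable def S (n k : ℕ) : Matrix ℕ ℕ (MvPolynomial (Fin 3) ℝ) :=
  (1 / 6 : ℝ) • ∑ σ : Equiv.Perm (Fin 3), (Y n k).map (MvPolynomial.rename σ)

/-- The upper left corner of a matrix over `ℝ[u,v,t]`, with rows and columns `0, …, r`,
evaluated at real numbers `u`, `v`, `t`. -/
noncomputable def corner (A : Matrix ℕ ℕ (MvPolynomial (Fin 3) ℝ)) (r : ℕ) (u v t : ℝ) :
    Matrix (Fin (r + 1)) (Fin (r + 1)) ℝ :=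
  Matrix.of fun i j => MvPolynomial.eval ![u, v, t] (A i j)

end SphereCode

namespace SphereCode

/-! The identity is the addition formula for the zonal polynomials. Substitute `t = u v + w x` with
`w² = (1-u²)(1-v²)`, so that `Q_s` becomes `w^s P_s^{n-1}(x)`. The claim is then an expansion of
`h_k^n P_k^n(t)` in the functions `q_s = h_s^{n-1} w^s P_s^{n-1}(x)` with coefficients `expCoeff`.

The proof is algebraic, by induction on `k` (`h_mul_P_eval_eq_sum`). The left side obeys a
three-term recurrence for multiplication by `t`. On the right, multiplication by `w x` is a
three-term operator in `s`, which summation by parts moves onto the coefficients. What remains is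
the scalar identity `expCoeff_rec`. It follows from the two relations between the parameters `m` and
`m + 2` (`P_eval_eq_shift`, `one_sub_sq_mul_P_eval`), the dimension formula and the functional
equation of `Γ`.

For positivity, the identity involves only diagonal entries, with nonnegative weights, and diagonal
entries of positive semidefinite matrices are nonnegative. -/

/-! ### Dimensions of the spaces of harmonic polynomials -/

open MvPolynomial in
theorem finrank_homogeneousSubmodule (n k : ℕ) :
    Module.finrank ℝ (homogeneousSubmodule (Fin n) ℝ k) = n.multichoose k := by
  have hset : {d : Fin n →₀ ℕ | d.degree = k} =
      ((Finset.univ : Finset (Fin n)).finsuppAntidiag k : Set (Fin n →₀ ℕ)) := by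
    ext d
    simp [Finsupp.degree_eq_sum]
  rw [homogeneousSubmodule_eq_finsupp_supported, hset]
  rw [(AddMonoidAlgebra.supportedEquivFinsupp
    ((Finset.univ : Finset (Fin n)).finsuppAntidiag k : Set (Fin n →₀ ℕ))).finrank_eq]
  rw [Module.finrank_finsupp_self]
  rw [show ∀ t : Finset (Fin n →₀ ℕ), Fintype.card (t : Set (Fin n →₀ ℕ)) = t.card from
    fun t => Fintype.card_coe t, Finset.card_finsuppAntidiag_nat_eq_multichoose, Finset.card_univ, Fintype.card_fin]

open MvPolynomial in
theorem laplacian_monomial (n : ℕ) (s : Fin n →₀ ℕ) (a : ℝ) :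
    laplacian n (monomial s a) =
      ∑ i, monomial (s - Finsupp.single i 2) (a * s i * (s i - 1 : ℕ)) := by
  simp only [laplacian, LinearMap.sum_apply, LinearMap.comp_apply, Derivation.coeFn_coe,
    pderiv_monomial]
  refine Finset.sum_congr rfl fun i _ => ?_
  rw [tsub_tsub, ← Finsupp.single_add]
  simp

open MvPolynomial in
theorem isHomogeneous_laplacian {n k : ℕ} {p : MvPolynomial (Fin n) ℝ}
    (hp : p.IsHomogeneous (k + 2)) : (laplacian n p).IsHomogeneous k := by
  simp only [laplacian, LinearMap.sum_apply, LinearMap.comp_apply, Derivation.coeFn_coe]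
  exact IsHomogeneous.sum _ _ _ fun i _ => hp.pderiv.pderiv

-- Induction on `e`, the degree in the variables other than `x_{i₀}`. The Laplacian of a multiple of
-- `x_{i₀}² x^s` is a multiple of `x^s` plus monomials in which `e` has dropped by 2.
open MvPolynomial in
theorem monomial_mem_map_laplacian {n : ℕ} (i₀ : Fin n) (k e : ℕ) (s : Fin n →₀ ℕ)
    (hs : s.degree = k) (he : k = e + s i₀) (a : ℝ) :
    monomial s a ∈ (homogeneousSubmodule (Fin n) ℝ (k + 2)).map (laplacian n) := by
  induction e using Nat.strong_induction_on generalizing s a with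
  | _ e ih =>
    set c : ℝ := a / ((s i₀ + 2) * (s i₀ + 1)) with hc
    have hdeg : (s + Finsupp.single i₀ 2).degree = k + 2 := by simp [hs]
    have h1 : laplacian n (monomial (s + Finsupp.single i₀ 2) c) ∈
        (homogeneousSubmodule (Fin n) ℝ (k + 2)).map (laplacian n) :=
      Submodule.mem_map_of_mem (isHomogeneous_monomial _ hdeg)
    rw [laplacian_monomial, ← Finset.add_sum_erase _ _ (Finset.mem_univ i₀)] at h1
    have h2 : monomial (s + Finsupp.single i₀ 2 - Finsupp.single i₀ 2)
        (c * (((s + Finsupp.single i₀ 2 : Fin n →₀ ℕ) i₀ : ℕ) : ℝ) *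
          (((s + Finsupp.single i₀ 2 : Fin n →₀ ℕ) i₀ - 1 : ℕ) : ℝ)) =
        monomial s a := by
      rw [add_tsub_cancel_right]
      congr 1
      simp only [Finsupp.add_apply, Finsupp.single_eq_same, Nat.add_succ_sub_one]
      push_cast
      rw [hc]
      field_simp
    rw [h2] at h1
    refine (Submodule.add_mem_iff_left _ (Submodule.sum_mem _ fun i hi => ?_)).1 h1
    have hne : i ≠ i₀ := (Finset.mem_erase.1 hi).1
    have hval : (s + Finsupp.single i₀ 2 : Fin n →₀ ℕ) i = s i := by
      simp [hne.symm]
    rw [hval]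
    by_cases h2i : 2 ≤ s i
    · have hle : Finsupp.single i 2 ≤ s + Finsupp.single i₀ 2 := by
        rw [Finsupp.single_le_iff, hval]; exact h2i
      have hd : (s + Finsupp.single i₀ 2 - Finsupp.single i 2).degree = k := by
        have := congrArg Finsupp.degree (tsub_add_cancel_of_le hle)
        rw [map_add, hdeg, Finsupp.degree_single] at this
        omega
      have hv : (s + Finsupp.single i₀ 2 - Finsupp.single i 2 : Fin n →₀ ℕ) i₀ = s i₀ + 2 := by
        simp [hne]
      have hle2 : s i + s i₀ ≤ k := by
        rw [← hs, Finsupp.degree_eq_sum, ← Finset.add_sum_erase _ _ (Finset.mem_univ i₀),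
          ← Finset.add_sum_erase _ _ (Finset.mem_erase.2 ⟨hne, Finset.mem_univ i⟩)]
        omega
      exact ih (e - 2) (by omega) _ hd (by omega) _
    · have : a * 0 = 0 := mul_zero a
      -- The second derivative in `x_i` kills a monomial of degree at most 1 in `x_i`.
      have h0 : ((s i : ℕ) : ℝ) * ((s i - 1 : ℕ) : ℝ) = 0 := by
        interval_cases s i <;> simp
      rw [mul_assoc, h0, mul_zero, monomial_zero]
      exact Submodule.zero_mem _

open MvPolynomial in
theorem map_laplacian_homogeneousSubmodule (n k : ℕ) (hn : 0 < n) :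
    (homogeneousSubmodule (Fin n) ℝ (k + 2)).map (laplacian n) =
      homogeneousSubmodule (Fin n) ℝ k := by
  refine le_antisymm ?_ fun p hp => ?_
  · rintro _ ⟨p, hp, rfl⟩
    exact isHomogeneous_laplacian hp
  · rw [p.as_sum]
    refine Submodule.sum_mem _ fun s hs => ?_
    have hd : s.degree = k := by
      rw [Finsupp.degree_eq_weight_one]
      exact hp (mem_support_iff.1 hs)
    refine monomial_mem_map_laplacian ⟨0, hn⟩ k (k - s ⟨0, hn⟩) s hd ?_ _
    have := Finsupp.le_degree (⟨0, hn⟩ : Fin n) s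
    omega

-- Rank-nullity for the Laplacian, which maps degree `k + 2` onto degree `k`.
open MvPolynomial in
theorem h_add_two (n k : ℕ) (hn : 0 < n) :
    h n (k + 2) + n.multichoose k = n.multichoose (k + 2) := by
  have hfin : Module.Finite ℝ (homogeneousSubmodule (Fin n) ℝ (k + 2)) :=
    Module.Finite.iff_fg.2 (homogeneousSubmodule_fg _ _ _)
  have hrk := ((laplacian n).domRestrict
    (homogeneousSubmodule (Fin n) ℝ (k + 2))).finrank_range_add_finrank_ker
  rw [LinearMap.range_domRestrict, map_laplacian_homogeneousSubmodule n k hn,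
    finrank_homogeneousSubmodule, finrank_homogeneousSubmodule] at hrk
  have hle : Harm n (k + 2) ≤ homogeneousSubmodule (Fin n) ℝ (k + 2) := inf_le_left
  have hker : ((laplacian n).domRestrict (homogeneousSubmodule (Fin n) ℝ (k + 2))).ker =
      (Harm n (k + 2)).comap (homogeneousSubmodule (Fin n) ℝ (k + 2)).subtype := by
    ext p
    simp [Harm, -mem_homogeneousSubmodule]
  rw [hker, (Submodule.comapSubtypeEquivOfLe hle).finrank_eq] at hrk
  rw [← hrk, add_comm, h]

open MvPolynomial in
theorem h_eq_multichoose_of_lt (n k : ℕ) (hk : k < 2) : h n k = n.multichoose k := by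
  rw [← finrank_homogeneousSubmodule, h, Harm, inf_eq_left.2]
  intro p hp
  rw [LinearMap.mem_ker, p.as_sum, map_sum]
  refine Finset.sum_eq_zero fun s hs => ?_
  have hd : s.degree = k := by
    rw [Finsupp.degree_eq_weight_one]
    exact hp (mem_support_iff.1 hs)
  rw [laplacian_monomial]
  refine Finset.sum_eq_zero fun i _ => ?_
  have := Finsupp.le_degree i s
  have h0 : ((s i : ℕ) : ℝ) * ((s i - 1 : ℕ) : ℝ) = 0 := by
    have : s i < 2 := by omega
    interval_cases s i <;> simp
  rw [mul_assoc, h0, mul_zero, monomial_zero]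

theorem h_zero (n : ℕ) : h n 0 = 1 := by
  simp [h_eq_multichoose_of_lt]

theorem h_one (n : ℕ) : h n 1 = n := by
  simp [h_eq_multichoose_of_lt]

theorem h_two (k : ℕ) : h 2 (k + 1) = 2 := by
  rcases k with _ | k
  · exact h_one 2
  · have := h_add_two 2 k (by norm_num)
    simp only [Nat.multichoose_two] at this
    rw [add_assoc, one_add_one_eq_two]
    omega

theorem multichoose_mul_factorial (m k : ℕ) :
    (m + 1).multichoose k * (k.factorial * m.factorial) = (k + m).factorial := by
  rw [Nat.multichoose_eq, show m + 1 + k - 1 = k + m by omega,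
    ← Nat.add_choose_mul_factorial_mul_factorial k m, Nat.choose_symm_add, mul_assoc]

/-- The dimension formula for harmonic polynomials in at least three variables. -/
theorem h_mul_factorial (m k : ℕ) :
    h (m + 3) k * (k.factorial * (m + 1).factorial) = (2 * k + m + 1) * (k + m).factorial := by
  match k with
  | 0 => simp [h_zero, Nat.factorial_succ]
  | 1 =>
    simp only [h_one, Nat.factorial_succ, Nat.factorial_zero, add_comm 1 m]
    ring
  | k + 2 =>
    have h1 := h_add_two (m + 3) k (by omega)
    have h2 := multichoose_mul_factorial (m + 2) k
    have h3 := multichoose_mul_factorial (m + 2) (k + 2)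
    have e1 : (k + 2 + (m + 2)).factorial =
        (k + m + 4) * ((k + m + 3) * (k + (m + 2)).factorial) := by
      rw [show k + 2 + (m + 2) = (k + (m + 2)) + 1 + 1 by ring, Nat.factorial_succ,
        Nat.factorial_succ]
      ring
    rw [e1, show m + 2 + 1 = m + 3 from rfl, ← h1] at h3
    rw [show m + 2 + 1 = m + 3 from rfl] at h2
    have e2 : (k + 2).factorial = (k + 2) * ((k + 1) * k.factorial) := by
      rw [Nat.factorial_succ, Nat.factorial_succ]
    have e3 : (m + 2).factorial = (m + 2) * (m + 1).factorial := Nat.factorial_succ _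
    rw [show k + 2 + m = k + (m + 2) by ring]
    refine Nat.eq_of_mul_eq_mul_left (show 0 < m + 2 by omega) ?_
    rw [e2, e3] at h3
    rw [e3] at h2
    rw [e2]
    zify at *
    linear_combination h3 - (k + 2) * (k + 1) * h2

theorem h_succ (m k : ℕ) (hm : 3 ≤ m) :
    (h m (k + 1) : ℝ) * ((k + 1) * (2 * k + m - 2)) = h m k * ((2 * k + m) * (k + m - 2)) := by
  obtain ⟨m, rfl⟩ := Nat.exists_eq_add_of_le' hm
  have h0 := congrArg (Nat.cast : ℕ → ℝ) (h_mul_factorial m k)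
  have h1 := congrArg (Nat.cast : ℕ → ℝ) (h_mul_factorial m (k + 1))
  rw [show k + 1 + m = (k + m) + 1 by ring] at h1
  simp only [Nat.factorial_succ] at h0 h1
  have hk : (k.factorial : ℝ) ≠ 0 := by positivity
  have hm' : (m.factorial : ℝ) ≠ 0 := by positivity
  push_cast at *
  refine mul_right_cancel₀ (mul_ne_zero hk (mul_ne_zero hm'
    (show (m : ℝ) + 1 ≠ 0 by positivity))) ?_
  linear_combination (2 * k + m + 1) * h1 - (2 * k + m + 3) * (k + m + 1) * h0

/-- With `h_succ`, this lets all dimensions in a coefficient identity be expressed through a single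
one. -/
theorem h_shift (m k : ℕ) (hm : 3 ≤ m) :
    (h (m + 2) k : ℝ) * (m * (m - 1)) = h m (k + 1) * ((k + m - 1) * (k + 1)) := by
  obtain ⟨m, rfl⟩ := Nat.exists_eq_add_of_le' hm
  have h0 := congrArg (Nat.cast : ℕ → ℝ) (h_mul_factorial (m + 2) k)
  have h1 := congrArg (Nat.cast : ℕ → ℝ) (h_mul_factorial m (k + 1))
  rw [show k + 1 + m = (k + m) + 1 by ring] at h1
  rw [show k + (m + 2) = (k + m) + 1 + 1 by ring] at h0
  rw [show m + 2 + 3 = m + 3 + 2 by ring] at h0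
  simp only [Nat.factorial_succ] at h0 h1
  have hk : (k.factorial : ℝ) ≠ 0 := by positivity
  have hm' : (m.factorial : ℝ) ≠ 0 := by positivity
  push_cast at *
  refine mul_right_cancel₀ (mul_ne_zero hk (mul_ne_zero hm'
    (show (m : ℝ) + 1 ≠ 0 by positivity))) ?_
  linear_combination h0 - (k + m + 2) * h1

theorem h_pos (m k : ℕ) (hm : 2 ≤ m) : 0 < h m k := by
  rcases hm.eq_or_lt with rfl | hm
  · rcases k with _ | k
    · simp [h_zero]
    · simp [h_two]
  · obtain ⟨m, rfl⟩ := Nat.exists_eq_add_of_le' (show 3 ≤ m from hm)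
    have := h_mul_factorial m k
    refine Nat.pos_of_ne_zero fun h0 => ?_
    rw [h0, zero_mul] at this
    exact absurd this.symm (by positivity)

/-! ### Recurrences and parameter shifts for the zonal polynomials -/

theorem gegenbauer_eval_add_two (l : ℝ) (k : ℕ) (x : ℝ) :
    ((k : ℝ) + 2) * (gegenbauer l (k + 2)).eval x =
      2 * (k + 1 + l) * x * (gegenbauer l (k + 1)).eval x -
        (k + 2 * l) * (gegenbauer l k).eval x := by
  have : (k : ℝ) + 2 ≠ 0 := by positivity
  rw [gegenbauer]
  simp only [Polynomial.eval_mul, Polynomial.eval_sub, Polynomial.eval_C, Polynomial.eval_X]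
  field_simp
  ring

theorem gegenbauer_eval_one_succ (l : ℝ) (k : ℕ) :
    ((k : ℝ) + 1) * (gegenbauer l (k + 1)).eval 1 = (k + 2 * l) * (gegenbauer l k).eval 1 := by
  induction k with
  | zero => simp [gegenbauer]
  | succ k ih =>
    have := gegenbauer_eval_add_two l k 1
    push_cast
    linear_combination this + ih

theorem gegenbauer_eval_one_pos {l : ℝ} (hl : 0 < l) (k : ℕ) :
    0 < (gegenbauer l k).eval 1 := by
  induction k with
  | zero => simp [gegenbauer]
  | succ k ih =>
    have := gegenbauer_eval_one_succ l k
    exact pos_of_mul_pos_right (this ▸ by positivity) (by positivity : (0 : ℝ) ≤ k + 1)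

theorem P_eval_zero (m : ℕ) (x : ℝ) : (P m 0).eval x = 1 := by
  unfold P
  split_ifs <;> simp [gegenbauer]

theorem P_eval_one (m : ℕ) (hm : 2 ≤ m) (x : ℝ) : (P m 1).eval x = x := by
  unfold P
  split_ifs with h2
  · simp
  · have : (0 : ℝ) < (m : ℝ) / 2 - 1 := by
      have : (3 : ℝ) ≤ m := by exact_mod_cast (show 3 ≤ m by omega)
      linarith
    simp only [gegenbauer, Polynomial.eval_mul, Polynomial.eval_C, Polynomial.eval_X]
    have h2' : 2 * ((m : ℝ) / 2 - 1) ≠ 0 := by positivity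
    rw [mul_one, ← mul_assoc, inv_mul_cancel₀ h2', one_mul]

/-- One recurrence covers Chebyshev and Gegenbauer polynomials alike; `m = 2` is needed because
`P^{n-1}` occurs with `n = 3`. -/
theorem P_eval_add_two (m k : ℕ) (hm : 2 ≤ m) (x : ℝ) :
    ((k : ℝ) + m - 1) * (P m (k + 2)).eval x =
      (2 * k + m) * x * (P m (k + 1)).eval x - (k + 1) * (P m k).eval x := by
  by_cases h2 : m = 2
  · subst h2
    have := congrArg (Polynomial.eval x) (Polynomial.Chebyshev.T_add_two ℝ (k : ℤ))
    simp only [P, if_true]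
    push_cast
    rw [this]
    simp
    ring
  · have hl : (0 : ℝ) < (m : ℝ) / 2 - 1 := by
      have : (3 : ℝ) ≤ m := by exact_mod_cast (show 3 ≤ m by omega)
      linarith
    obtain ⟨l, hl'⟩ : ∃ l, l = (m : ℝ) / 2 - 1 := ⟨_, rfl⟩
    rw [← hl'] at hl
    have hm' : (m : ℝ) = 2 * l + 2 := by rw [hl']; ring
    simp only [P, if_neg h2, Polynomial.eval_mul, Polynomial.eval_C]
    rw [← hl', hm']
    have p0 := gegenbauer_eval_one_pos hl k
    have e1 := gegenbauer_eval_one_succ l k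
    have e2 := gegenbauer_eval_one_succ l (k + 1)
    have r := gegenbauer_eval_add_two l k x
    push_cast at e2
    -- All normalizing values become multiples of the one at `k`, which cancels.
    have e1' : (gegenbauer l (k + 1)).eval 1 =
        (k + 2 * l) / (k + 1) * (gegenbauer l k).eval 1 := by
      field_simp; linear_combination e1
    have e2' : (gegenbauer l (k + 2)).eval 1 =
        (k + 1 + 2 * l) / (k + 2) * ((k + 2 * l) / (k + 1) * (gegenbauer l k).eval 1) := by
      rw [← e1']; field_simp; linear_combination e2
    have r' : (gegenbauer l (k + 2)).eval x =
      (2 * (k + 1 + l) * x * (gegenbauer l (k + 1)).eval x -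
        (k + 2 * l) * (gegenbauer l k).eval x) / (k + 2) := by
      field_simp; linear_combination r
    rw [e1', e2', r']
    have n1 : (k : ℝ) + 2 * l ≠ 0 := by positivity
    have n2 : (k : ℝ) + 1 + 2 * l ≠ 0 := by positivity
    field_simp
    ring

/-- Multiplication by the variable. -/
theorem mul_P_eval (m k : ℕ) (hm : 2 ≤ m) (x : ℝ) :
    x * (P m (k + 1)).eval x =
      (k + m - 1) / (2 * k + m) * (P m (k + 2)).eval x +
        (k + 1) / (2 * k + m) * (P m k).eval x := by
  have : (2 * k + m : ℝ) ≠ 0 := by positivity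
  have := P_eval_add_two m k hm x
  field_simp
  linear_combination -this

theorem P_eval_two (m : ℕ) (hm : 2 ≤ m) (x : ℝ) :
    (P m 2).eval x = (m * x ^ 2 - 1) / (m - 1) := by
  have h2 : (2 : ℝ) ≤ m := by exact_mod_cast hm
  have h1 : (m : ℝ) - 1 ≠ 0 := by linarith
  have := P_eval_add_two m 0 hm x
  simp only [zero_add, P_eval_one m hm, P_eval_zero] at this
  push_cast at this
  field_simp
  linear_combination this

theorem P_eval_three (m : ℕ) (hm : 2 ≤ m) (x : ℝ) :
    (P m 3).eval x = ((m + 2) * x ^ 3 - 3 * x) / (m - 1) := by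
  have h2 : (2 : ℝ) ≤ m := by exact_mod_cast hm
  have h1 : (m : ℝ) - 1 ≠ 0 := by linarith
  have h0 : (m : ℝ) ≠ 0 := by linarith
  have := P_eval_add_two m 1 hm x
  simp only [Nat.reduceAdd, P_eval_two m hm, P_eval_one m hm] at this
  push_cast at this
  refine mul_left_cancel₀ h0 ?_
  rw [show (m : ℝ) * (P m 3).eval x = (1 + m - 1) * (P m 3).eval x by ring, this]
  field_simp
  ring

/-- The connection between the parameters `m` and `m + 2`. -/
theorem P_eval_eq_shift (m k : ℕ) (hm : 2 ≤ m) (x : ℝ) :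
    (P m (k + 2)).eval x =
      (m + k) * (m + k + 1) / ((2 * k + m + 2) * (m - 1)) * (P (m + 2) (k + 2)).eval x -
        (k + 2) * (k + 1) / ((2 * k + m + 2) * (m - 1)) * (P (m + 2) k).eval x := by
  have h2 : (2 : ℝ) ≤ m := by exact_mod_cast hm
  have h1 : (m : ℝ) - 1 ≠ 0 := by linarith
  have h0 : (m : ℝ) ≠ 0 := by linarith
  induction k using Nat.twoStepInduction with
  | zero =>
    simp only [zero_add, P_eval_two m hm, P_eval_two (m + 2) (by omega), P_eval_zero]
    push_cast
    have : (m : ℝ) + 2 - 1 ≠ 0 := by linarith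
    field_simp
    ring
  | one =>
    simp only [Nat.reduceAdd, P_eval_three m hm, P_eval_three (m + 2) (by omega),
      P_eval_one (m + 2) (by omega)]
    push_cast
    have : (m : ℝ) + 2 - 1 ≠ 0 := by linarith
    field_simp
    ring
  -- The recurrence for `m` and the induction hypotheses, followed by `mul_P_eval` for `m + 2`, turn
  -- both sides into combinations of `P (m + 2)` at `k`, `k + 2`, `k + 4`.
  | more k ih0 ih1 =>
    have r := P_eval_add_two m (k + 2) hm x
    have a := mul_P_eval (m + 2) (k + 2) (by omega) x
    have b := mul_P_eval (m + 2) k (by omega) x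
    have n1 : (k : ℝ) + m + 1 ≠ 0 := by positivity
    have n2 : (k : ℝ) + 2 + m - 1 ≠ 0 := by intro h; apply n1; linarith
    push_cast at *
    refine mul_left_cancel₀ n2 ?_
    rw [show k + 1 + 1 + 2 = k + 2 + 2 by ring, r, show k + 1 + 1 = k + 2 by ring,
      show k + 2 + 1 = k + 1 + 2 by ring, mul_assoc, ih1, mul_sub, mul_left_comm x,
      mul_left_comm x, ih0, b, show k + 1 + 2 = k + 2 + 1 by ring, a]
    have d1 : (2 * (k : ℝ) + m + 2) ≠ 0 := by positivity
    have d2 : (2 * (k : ℝ) + m + 4) ≠ 0 := by positivity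
    have d3 : (2 * (k : ℝ) + m + 6) ≠ 0 := by positivity
    field_simp
    ring

/-- The counterpart of `P_eval_eq_shift`: `1 - x²` is the ratio of the orthogonality weights for `m
+ 2` and `m`, so multiplying by it is adjoint to that change of basis. -/
theorem one_sub_sq_mul_P_eval (m k : ℕ) (hm : 2 ≤ m) (x : ℝ) :
    (1 - x ^ 2) * (P (m + 2) k).eval x =
      (m - 1) / (2 * k + m) * ((P m k).eval x - (P m (k + 2)).eval x) := by
  have h2 : (2 : ℝ) ≤ m := by exact_mod_cast hm
  have h1 : (m : ℝ) - 1 ≠ 0 := by linarith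
  have h0 : (m : ℝ) ≠ 0 := by linarith
  induction k using Nat.twoStepInduction with
  | zero =>
    simp only [zero_add, P_eval_two m hm, P_eval_zero]
    push_cast
    field_simp
    ring
  | one =>
    simp only [Nat.reduceAdd, P_eval_three m hm, P_eval_one m hm, P_eval_one (m + 2) (by omega)]
    push_cast
    have : (m : ℝ) + 2 ≠ 0 := by linarith
    field_simp
    ring
  | more k ih0 ih1 =>
    have r := P_eval_add_two (m + 2) k (by omega) x
    have a := mul_P_eval m (k + 2) hm x
    have b := mul_P_eval m k hm x
    have n1 : (k : ℝ) + m + 1 ≠ 0 := by positivity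
    have n2 : (k : ℝ) + (m + 2) - 1 ≠ 0 := by intro h; apply n1; linarith
    push_cast at *
    rw [show k + 1 + 2 = k + 2 + 1 by ring] at ih1
    refine mul_left_cancel₀ n2 ?_
    rw [mul_left_comm, r]
    have d0 : (2 * (k : ℝ) + m) ≠ 0 := by positivity
    have d1 : (2 * (k : ℝ) + m + 2) ≠ 0 := by positivity
    have d2 : (2 * (k : ℝ) + m + 4) ≠ 0 := by positivity
    have e : (1 - x ^ 2) * ((2 * (k : ℝ) + (m + 2)) * x * (P (m + 2) (k + 1)).eval x -
        (k + 1) * (P (m + 2) k).eval x) =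
        (2 * (k : ℝ) + (m + 2)) * (x * ((1 - x ^ 2) * (P (m + 2) (k + 1)).eval x)) -
        (k + 1) * ((1 - x ^ 2) * (P (m + 2) k).eval x) := by ring
    rw [e, ih0, ih1, mul_left_comm x, mul_sub x, a, b]
    field_simp
    ring

/-! ### Ratios of sphere areas -/

theorem sphereArea_pos (m : ℕ) (hm : 0 < m) : 0 < sphereArea m := by
  have hm' : (0 : ℝ) < m := by exact_mod_cast hm
  have := Real.Gamma_pos_of_pos (half_pos hm')
  unfold sphereArea
  positivity

theorem sphereArea_add_two (m : ℕ) (hm : 0 < m) :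
    sphereArea (m + 2) = sphereArea m * (2 * Real.pi / m) := by
  have hm' : (0 : ℝ) < m := by exact_mod_cast hm
  have hG := Real.Gamma_pos_of_pos (half_pos hm')
  unfold sphereArea
  push_cast
  rw [show ((m : ℝ) + 2) / 2 = m / 2 + 1 by ring, Real.Gamma_add_one (half_pos hm').ne',
    Real.rpow_add_one Real.pi_ne_zero]
  field_simp

/-- The quotient of sphere areas that occurs in `lam`. -/
noncomputable def areaRatio (n s : ℕ) : ℝ :=
  sphereArea n / sphereArea (n - 1) * (sphereArea (n + 2 * s - 1) / sphereArea (n + 2 * s))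

theorem areaRatio_zero (n : ℕ) (hn : 3 ≤ n) : areaRatio n 0 = 1 := by
  have h1 := (sphereArea_pos n (by omega)).ne'
  have h2 := (sphereArea_pos (n - 1) (by omega)).ne'
  simp only [areaRatio, mul_zero, add_zero]
  field_simp

theorem areaRatio_succ (n s : ℕ) (hn : 3 ≤ n) :
    areaRatio n (s + 1) = areaRatio n s * ((n + 2 * s) / (n + 2 * s - 1)) := by
  have h3 := (sphereArea_pos (n + 2 * s - 1) (by omega)).ne'
  have h4 := (sphereArea_pos (n + 2 * s) (by omega)).ne'
  have hn' : (3 : ℝ) ≤ n := by exact_mod_cast hn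
  have hs : (0 : ℝ) ≤ s := by positivity
  have h5 : (n : ℝ) + 2 * s - 1 ≠ 0 := by linarith
  have h6 : (n : ℝ) + 2 * s ≠ 0 := by positivity
  have hc : ((n + 2 * s - 1 : ℕ) : ℝ) = n + 2 * s - 1 := by
    rw [Nat.cast_sub (by omega)]; push_cast; ring
  unfold areaRatio
  rw [show n + 2 * (s + 1) - 1 = (n + 2 * s - 1) + 2 by omega,
    show n + 2 * (s + 1) = n + 2 * s + 2 by ring, sphereArea_add_two _ (by omega),
    sphereArea_add_two _ (by omega), hc]
  push_cast
  have := Real.pi_ne_zero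
  field_simp

/-! ### The addition formula -/

/-- The coefficient of `h_s^{n-1} Q_s^{n-1}` in the expansion of `h_k^n P_k^n(t)`. -/
noncomputable def expCoeff (n : ℕ) (u v : ℝ) (k s : ℕ) : ℝ :=
  if s ≤ k then areaRatio n s *
    (h (n + 2 * s) (k - s) * ((P (n + 2 * s) (k - s)).eval u * (P (n + 2 * s) (k - s)).eval v))
  else 0

theorem expCoeff_of_lt {n : ℕ} {u v : ℝ} {k s : ℕ} (hks : k < s) : expCoeff n u v k s = 0 :=
  if_neg (by omega)

theorem expCoeff_add (n : ℕ) (u v : ℝ) (s j : ℕ) : expCoeff n u v (s + j) s =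
    areaRatio n s *
      (h (n + 2 * s) j * ((P (n + 2 * s) j).eval u * (P (n + 2 * s) j).eval v)) := by
  rw [expCoeff, if_pos (by omega), Nat.add_sub_cancel_left]

/-- The factor with which `h_{s+1} P_{s+1}` occurs in `t h_s P_s`, shifted by one. -/
noncomputable def downCoeff (m s : ℕ) : ℝ := s / (2 * s + m - 2)

/-- The factor with which `h_{s-1} P_{s-1}` occurs in `t h_s P_s`, shifted by one. -/
noncomputable def upCoeff (m s : ℕ) : ℝ := if s = 0 then 1 else (s + m - 2) / (2 * s + m - 2)

/-- Multiplication by `x` is self-adjoint and `P_s` has squared norm `1 / h_s`: this is the symmetry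
of its matrix. -/
theorem h_mul_upCoeff (m s : ℕ) (hm : 2 ≤ m) :
    h m s * upCoeff m s = h m (s + 1) * downCoeff m (s + 1) := by
  have hm' : (2 : ℝ) ≤ m := by exact_mod_cast hm
  unfold upCoeff downCoeff
  split_ifs with hs
  · subst hs
    have : (m : ℝ) ≠ 0 := by linarith
    simp [h_zero, h_one]
    field_simp
  · have hs' : (1 : ℝ) ≤ s := by exact_mod_cast Nat.one_le_iff_ne_zero.2 hs
    rcases hm.eq_or_lt with rfl | hm
    · obtain ⟨s, rfl⟩ := Nat.exists_eq_succ_of_ne_zero hs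
      simp only [h_two, Nat.succ_eq_add_one]
      push_cast
      have : (s : ℝ) + 1 ≠ 0 := by positivity
      have : (s : ℝ) + 1 + 1 ≠ 0 := by positivity
      simp only [add_sub_cancel_right]
      field_simp
    · have := h_succ m s hm
      have h1 : 2 * (s : ℝ) + m - 2 ≠ 0 := by linarith
      have h2 : 2 * (s : ℝ) + m ≠ 0 := by linarith
      push_cast
      rw [show 2 * ((s : ℝ) + 1) + m - 2 = 2 * s + m by ring, ← mul_div_assoc, ← mul_div_assoc,
        div_eq_div_iff h1 h2]
      linear_combination -this

theorem mul_h_mul_P_eval (m s : ℕ) (hm : 2 ≤ m) (x : ℝ) :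
    x * (h m (s + 1) * (P m (s + 1)).eval x) =
      downCoeff m (s + 2) * (h m (s + 2) * (P m (s + 2)).eval x) +
        upCoeff m s * (h m s * (P m s).eval x) := by
  have a := h_mul_upCoeff m s hm
  have b := h_mul_upCoeff m (s + 1) hm
  have e1 : upCoeff m (s + 1) = (s + m - 1) / (2 * s + m) := by
    rw [upCoeff, if_neg (by omega)]; push_cast; congr 1 <;> ring
  have e2 : downCoeff m (s + 1) = (s + 1) / (2 * s + m) := by
    rw [downCoeff]; push_cast; congr 1; ring
  rw [e1] at b
  rw [e2] at a
  have := mul_P_eval m s hm x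
  linear_combination (h m (s + 1) : ℝ) * this + (P m (s + 2)).eval x * b - (P m s).eval x * a

/-- Brings the index `s` term to the factor `areaRatio n (s + 1)`, which then cancels from
`expCoeff_rec`. -/
theorem downCoeff_mul_areaRatio (n s : ℕ) (hn : 3 ≤ n) :
    downCoeff (n - 1) (s + 1) * areaRatio n s = (s + 1) / (n + 2 * s) * areaRatio n (s + 1) := by
  have hn' : (3 : ℝ) ≤ n := by exact_mod_cast hn
  have hs : (0 : ℝ) ≤ s := by positivity
  have h5 : (n : ℝ) + 2 * s - 1 ≠ 0 := by linarith
  have h6 : (n : ℝ) + 2 * s ≠ 0 := by positivity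
  rw [areaRatio_succ n s hn, downCoeff, Nat.cast_sub (by omega)]
  push_cast
  rw [show 2 * ((s : ℝ) + 1) + (n - 1) - 2 = n + 2 * s - 1 by ring]
  field_simp

theorem h_succ_eq (m k : ℕ) (hm : 3 ≤ m) :
    (h m (k + 1) : ℝ) = (2 * k + m) * (k + m - 2) / ((k + 1) * (2 * k + m - 2)) * h m k := by
  have hm' : (3 : ℝ) ≤ m := by exact_mod_cast hm
  have hk : (0 : ℝ) ≤ k := by positivity
  have h1 : 2 * (k : ℝ) + m - 2 ≠ 0 := by linarith
  have := h_succ m k hm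
  rw [div_mul_eq_mul_div, eq_div_iff (mul_ne_zero (by positivity) h1)]
  linear_combination this

theorem h_shift_eq (m k : ℕ) (hm : 3 ≤ m) :
    (h (m + 2) k : ℝ) = (k + m - 1) * (k + 1) / (m * (m - 1)) * h m (k + 1) := by
  have hm' : (3 : ℝ) ≤ m := by exact_mod_cast hm
  have h1 : (m : ℝ) - 1 ≠ 0 := by linarith
  have := h_shift m k hm
  rw [div_mul_eq_mul_div, eq_div_iff (mul_ne_zero (by positivity) h1)]
  linear_combination this

/-- The exceptional value at 0 matters only in dimension 2, where the quotient is `0 / 0`. -/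
theorem upCoeff_eq (n k : ℕ) (hn : 3 ≤ n) : upCoeff n k = (k + n - 2) / (2 * k + n - 2) := by
  have hn' : (3 : ℝ) ≤ n := by exact_mod_cast hn
  have h1 : (n : ℝ) - 2 ≠ 0 := by linarith
  unfold upCoeff
  split_ifs with hk
  · simp [hk, div_self h1]
  · rfl

theorem expCoeff_rec_of_eq_zero (n j : ℕ) (hn : 3 ≤ n) (u v : ℝ) :
    u * v * expCoeff n u v (j + 1) 0 +
      (1 - u ^ 2) * (1 - v ^ 2) * expCoeff n u v (j + 1) 1 =
    downCoeff n (j + 2) * expCoeff n u v (j + 2) 0 + upCoeff n j * expCoeff n u v j 0 := by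
  have hn' : (3 : ℝ) ≤ n := by exact_mod_cast hn
  have hj : (0 : ℝ) ≤ j := by positivity
  have c1 := expCoeff_add n u v 0 (j + 1)
  have c2 := expCoeff_add n u v 0 (j + 2)
  have c0 := expCoeff_add n u v 0 j
  have c3 := expCoeff_add n u v 1 j
  simp only [zero_add, add_comm 1 j, mul_zero, add_zero, mul_one, areaRatio_zero n hn,
    areaRatio_succ n 0 hn, one_mul, Nat.cast_zero] at c0 c1 c2 c3
  rw [c0, c1, c2, c3]
  have xu := mul_P_eval n j (by omega) u
  have xv := mul_P_eval n j (by omega) v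
  have yu := one_sub_sq_mul_P_eval n j (by omega) u
  have yv := one_sub_sq_mul_P_eval n j (by omega) v
  have e1 : ∀ a x y : ℝ, u * v * (a * (x * y)) = a * ((u * x) * (v * y)) := by intros; ring
  have e2 : ∀ b a x y : ℝ, (1 - u ^ 2) * (1 - v ^ 2) * (b * (a * (x * y))) =
    b * a * (((1 - u ^ 2) * x) * ((1 - v ^ 2) * y)) := by intros; ring
  rw [e1, e2, xu, xv, yu, yv, h_shift_eq n j hn, h_succ_eq n (j + 1) hn, h_succ_eq n j hn,
    upCoeff_eq n j hn, downCoeff]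
  push_cast
  rw [show 2 * ((j : ℝ) + 1) + n - 2 = 2 * j + n by ring,
    show 2 * ((j : ℝ) + 2) + n - 2 = 2 * j + n + 2 by ring]
  have n1 : 2 * (j : ℝ) + n - 2 ≠ 0 := by linarith
  have n2 : (n : ℝ) - 1 ≠ 0 := by linarith
  have n3 : (n : ℝ) ≠ 0 := by linarith
  have n4 : 2 * (j : ℝ) + n ≠ 0 := by linarith
  have n5 : 2 * (j : ℝ) + n + 2 ≠ 0 := by linarith
  field_simp
  ring

/-- With `m = n + 2s`, the parameters `m`, `m + 2`, `m + 4` occur. Everything is rewritten in `P (m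
+ 2)` at degrees `j` and `j + 2` and in `h (m + 2) j`, leaving an identity of rational functions. -/
theorem expCoeff_rec_of_pos (n s j : ℕ) (hn : 3 ≤ n) (u v : ℝ) :
    u * v * expCoeff n u v (s + 1 + j + 1) (s + 1) +
      downCoeff (n - 1) (s + 1) * expCoeff n u v (s + 1 + j + 1) s +
      upCoeff (n - 1) (s + 1) *
        ((1 - u ^ 2) * (1 - v ^ 2) * expCoeff n u v (s + 1 + j + 1) (s + 1 + 1)) =
    downCoeff n (s + 1 + j + 2) * expCoeff n u v (s + 1 + j + 2) (s + 1) +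
      upCoeff n (s + 1 + j) * expCoeff n u v (s + 1 + j) (s + 1) := by
  have hn' : (3 : ℝ) ≤ n := by exact_mod_cast hn
  have hj : (0 : ℝ) ≤ j := by positivity
  have hs : (0 : ℝ) ≤ s := by positivity
  obtain ⟨m, hm⟩ : ∃ m, m = n + 2 * s := ⟨_, rfl⟩
  have hmn : (n : ℝ) = m - 2 * s := by rw [hm]; push_cast; ring
  have hm3 : 3 ≤ m := by omega
  have hm' : (3 : ℝ) ≤ m := by exact_mod_cast hm3
  rw [show s + 1 + j + 1 = s + (j + 2) by ring, expCoeff_add n u v s (j + 2),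
    show s + (j + 2) = s + 1 + (j + 1) by ring, expCoeff_add n u v (s + 1) (j + 1),
    show s + 1 + (j + 1) = s + 1 + 1 + j by ring, expCoeff_add n u v (s + 1 + 1) j,
    show s + 1 + j + 2 = s + 1 + (j + 2) by ring, expCoeff_add n u v (s + 1) (j + 2),
    expCoeff_add n u v (s + 1) j, ← mul_assoc (downCoeff (n - 1) (s + 1)),
    downCoeff_mul_areaRatio n s hn, areaRatio_succ n (s + 1) hn,
    show n + 2 * (s + 1 + 1) = m + 2 + 2 by omega, show n + 2 * (s + 1) = m + 2 by omega, ← hm]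
  have xu := mul_P_eval (m + 2) j (by omega) u
  have xv := mul_P_eval (m + 2) j (by omega) v
  have yu := one_sub_sq_mul_P_eval (m + 2) j (by omega) u
  have yv := one_sub_sq_mul_P_eval (m + 2) j (by omega) v
  have e1 : ∀ b a x y : ℝ, u * v * (b * (a * (x * y))) = b * a * ((u * x) * (v * y)) := by
    intros; ring
  have e2 : ∀ b a x y : ℝ, (1 - u ^ 2) * (1 - v ^ 2) * (b * (a * (x * y))) =
    b * a * (((1 - u ^ 2) * x) * ((1 - v ^ 2) * y)) := by intros; ring
  have n1 : 2 * (j : ℝ) + m ≠ 0 := by linarith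
  have n2 : (m : ℝ) - 1 ≠ 0 := by linarith
  have n3 : (m : ℝ) ≠ 0 := by linarith
  have n4 : 2 * (j : ℝ) + m + 2 ≠ 0 := by linarith
  have n5 : 2 * (j : ℝ) + m + 4 ≠ 0 := by linarith
  have n6 : (m : ℝ) + 1 ≠ 0 := by linarith
  have n7 : (m : ℝ) + 2 ≠ 0 := by linarith
  have n8 : (j : ℝ) + m ≠ 0 := by linarith
  have n9 : (j : ℝ) + 2 ≠ 0 := by linarith
  have hold : (h m (j + 2) : ℝ) =
      m * (m - 1) / ((j + m) * (j + 2)) * h (m + 2) (j + 1) := by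
    have := h_shift_eq m (j + 1) hm3
    push_cast at this
    rw [this, show (j : ℝ) + 1 + m - 1 = j + m by ring, show (j : ℝ) + 1 + 1 = j + 2 by ring]
    field_simp
  have hup : upCoeff (n - 1) (s + 1) = (m - s - 2) / (m - 1) := by
    rw [upCoeff, if_neg (by omega), Nat.cast_sub (by omega), hmn]
    push_cast
    congr 1 <;> ring
  have hup' : upCoeff n (s + 1 + j) = (m - s + j - 1) / (2 * j + m) := by
    rw [upCoeff_eq n _ hn, hmn]
    push_cast
    congr 1 <;> ring
  have hdown : downCoeff n (s + 1 + (j + 2)) = (s + j + 3) / (2 * j + m + 4) := by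
    rw [downCoeff, hmn]
    push_cast
    congr 1 <;> ring
  rw [e1, e2, xu, xv, yu, yv, P_eval_eq_shift m j (by omega), P_eval_eq_shift m j (by omega), hold,
    h_shift_eq (m + 2) j (by omega), h_succ_eq (m + 2) (j + 1) (by omega),
    h_succ_eq (m + 2) j (by omega), hup, hup', hdown]
  push_cast
  rw [hmn, show (m : ℝ) - 2 * s + 2 * s = m by ring,
    show (m : ℝ) - 2 * s + 2 * (s + 1) = m + 2 by ring,
    show (m : ℝ) + 2 - 1 = m + 1 by ring,
    show 2 * ((j : ℝ) + 1) + (m + 2) - 2 = 2 * j + m + 2 by ring,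
    show 2 * ((j : ℝ) + 1) + (m + 2) = 2 * j + m + 4 by ring,
    show 2 * (j : ℝ) + (m + 2) - 2 = 2 * j + m by ring,
    show 2 * (j : ℝ) + (m + 2) = 2 * j + m + 2 by ring,
    show (j : ℝ) + (m + 2) - 2 = j + m by ring]
  field_simp
  ring

/-- Compares the coefficients of `q_s` in `t h_{k+1} P_{k+1}(t)`. The truncated `s - 1` is harmless
at `s = 0`, as `downCoeff` vanishes there. -/
theorem expCoeff_rec (n k s : ℕ) (hn : 3 ≤ n) (u v : ℝ) :
    u * v * expCoeff n u v (k + 1) s +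
      downCoeff (n - 1) s * expCoeff n u v (k + 1) (s - 1) +
      upCoeff (n - 1) s * ((1 - u ^ 2) * (1 - v ^ 2) * expCoeff n u v (k + 1) (s + 1)) =
    downCoeff n (k + 2) * expCoeff n u v (k + 2) s + upCoeff n k * expCoeff n u v k s := by
  have hn' : (3 : ℝ) ≤ n := by exact_mod_cast hn
  have hk : (0 : ℝ) ≤ k := by positivity
  rcases le_or_gt s k with hs | hs
  · obtain ⟨j, rfl⟩ := Nat.exists_eq_add_of_le hs
    rcases s with _ | s
    · have := expCoeff_rec_of_eq_zero n j hn u v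
      simp only [zero_add]
      rw [← this]
      simp [downCoeff, upCoeff]
    · exact expCoeff_rec_of_pos n s j hn u v
  · obtain ⟨s, rfl⟩ := Nat.exists_eq_add_of_lt hs
    rw [expCoeff_of_lt (show k + 1 < k + s + 1 + 1 by omega), expCoeff_of_lt hs,
      Nat.add_sub_cancel]
    -- The index is now `k + s + 1`: the surviving polynomials have degree 0 or 1, and from `s = 2`
    -- on none survive.
    match s with
    | 0 =>
      have c1 := expCoeff_add n u v (k + 1) 0
      have c2 := expCoeff_add n u v k 1
      have c3 := expCoeff_add n u v (k + 1) 1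
      simp only [add_zero, P_eval_zero, h_zero, h_one, P_eval_one _ (show 2 ≤ n + 2 * k by omega),
        P_eval_one _ (show 2 ≤ n + 2 * (k + 1) by omega)] at c1 c2 c3 ⊢
      rw [c1, c2, c3, ← mul_assoc (downCoeff (n - 1) (k + 1)), downCoeff_mul_areaRatio n k hn,
        downCoeff]
      push_cast
      have n1 : (n : ℝ) + 2 * k ≠ 0 := by linarith
      have n2 : (n : ℝ) + 2 * k + 2 ≠ 0 := by linarith
      rw [show 2 * ((k : ℝ) + 2) + n - 2 = n + 2 * k + 2 by ring]
      field_simp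
      ring
    | 1 =>
      have c1 := expCoeff_add n u v (k + 1) 0
      have c2 := expCoeff_add n u v (k + 2) 0
      simp only [add_zero, P_eval_zero, h_zero] at c1 c2 ⊢
      rw [show k + 1 + 1 = k + 2 by ring, c1, c2, expCoeff_of_lt (show k + 1 < k + 2 by omega),
        ← mul_assoc (downCoeff (n - 1) (k + 2)), downCoeff_mul_areaRatio n (k + 1) hn, downCoeff]
      push_cast
      rw [show 2 * ((k : ℝ) + 2) + n - 2 = n + 2 * (k + 1) by ring]
      ring
    | s + 2 =>
      rw [expCoeff_of_lt (show k + 1 < k + (s + 2) + 1 by omega),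
        expCoeff_of_lt (show k + 1 < k + (s + 2) by omega),
        expCoeff_of_lt (show k + 2 < k + (s + 2) + 1 by omega)]
      ring

/-- Multiplication by an operator with a three term recurrence, summed by parts. -/
theorem sum_mul_three_term (q a d e : ℕ → ℝ) (y : ℝ) (h0 : y * q 0 = d 1 * q 1)
    (h1 : ∀ s, y * q (s + 1) = d (s + 2) * q (s + 2) + e s * q s) (hd : d 0 = 0) (N : ℕ) :
    ∑ s ∈ Finset.range (N + 1), (d s * a (s - 1) + e s * a (s + 1)) * q s =
      y * ∑ s ∈ Finset.range (N + 1), a s * q s -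
        d (N + 1) * a N * q (N + 1) + e N * a (N + 1) * q N := by
  induction N with
  | zero =>
    simp only [zero_add, Finset.range_one, Finset.sum_singleton, hd]
    linear_combination -a 0 * h0
  | succ N ih =>
    rw [Finset.sum_range_succ, ih, Finset.sum_range_succ _ (N + 1), Nat.add_sub_cancel]
    linear_combination -a (N + 1) * h1 N

/-- The addition formula, evaluated. -/
theorem h_mul_P_eval_eq_sum (n k : ℕ) (hn : 3 ≤ n) (u v w x : ℝ)
    (hw : w ^ 2 = (1 - u ^ 2) * (1 - v ^ 2)) :
    h n k * (P n k).eval (u * v + w * x) =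
      ∑ s ∈ Finset.range (k + 1), expCoeff n u v k s *
        (h (n - 1) s * (w ^ s * (P (n - 1) s).eval x)) := by
  have hn2 : 2 ≤ n := by omega
  have hn1 : 2 ≤ n - 1 := by omega
  have hn' : (3 : ℝ) ≤ n := by exact_mod_cast hn
  have hcast : ((n - 1 : ℕ) : ℝ) = n - 1 := by rw [Nat.cast_sub (by omega)]; simp
  have hn0 : (n : ℝ) - 1 ≠ 0 := by linarith
  set q : ℕ → ℝ := fun s => h (n - 1) s * (w ^ s * (P (n - 1) s).eval x) with hq
  -- Zero padding gives the three sums of the recurrence a common range.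
  have hext : ∀ k M, k + 1 ≤ M → ∑ s ∈ Finset.range (k + 1), expCoeff n u v k s * q s =
      ∑ s ∈ Finset.range M, expCoeff n u v k s * q s := by
    intro k M hM
    refine Finset.sum_subset (Finset.range_mono hM) fun s _ hs => ?_
    rw [expCoeff_of_lt (by simpa using hs), zero_mul]
  have hq0 : w * x * q 0 = downCoeff (n - 1) 1 * q 1 := by
    simp only [hq, h_zero, h_one, P_eval_zero, P_eval_one _ hn1, downCoeff, hcast]
    push_cast
    rw [show 2 * (1 : ℝ) + (n - 1) - 2 = n - 1 by ring]
    field_simp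
  have hq1 : ∀ s, w * x * q (s + 1) = downCoeff (n - 1) (s + 2) * q (s + 2) +
      upCoeff (n - 1) s * ((1 - u ^ 2) * (1 - v ^ 2)) * q s := by
    intro s
    have := mul_h_mul_P_eval (n - 1) s hn1 x
    rw [← hw]
    simp only [hq]
    linear_combination w ^ (s + 2) * this
  induction k using Nat.twoStepInduction with
  | zero =>
    have := expCoeff_add n u v 0 0
    simp only [add_zero, mul_zero, h_zero, P_eval_zero, areaRatio_zero n hn] at this
    simp [h_zero, P_eval_zero, this]
  | one =>
    have c0 := expCoeff_add n u v 0 1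
    have c1 := expCoeff_add n u v 1 0
    simp only [add_zero, mul_zero, zero_add, h_zero, h_one, P_eval_zero, P_eval_one n hn2,
      areaRatio_zero n hn, areaRatio_succ n 0 hn] at c0 c1
    simp only [Finset.sum_range_succ, Finset.sum_range_zero, c0, c1, h_zero, h_one,
      P_eval_zero, P_eval_one n hn2, P_eval_one _ hn1, hcast]
    push_cast
    simp only [mul_zero, add_zero]
    field_simp
    ring
  | more k ih0 ih1 =>
    have hd : downCoeff n (k + 2) ≠ 0 := by
      have : (0 : ℝ) < 2 * ((k : ℝ) + 2) + n - 2 := by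
        have : (0 : ℝ) ≤ k := by positivity
        linarith
      unfold downCoeff
      push_cast
      positivity
    have hrec := mul_h_mul_P_eval n k hn2 (u * v + w * x)
    rw [ih0, ih1, hext k (k + 3) (by omega), hext (k + 1) (k + 3) (by omega)] at hrec
    have hsum := sum_mul_three_term q (expCoeff n u v (k + 1)) (downCoeff (n - 1))
      (fun s => upCoeff (n - 1) s * ((1 - u ^ 2) * (1 - v ^ 2))) (w * x) hq0 hq1
      (by simp [downCoeff]) (k + 2)
    -- Both boundary terms of the summation by parts vanish.
    rw [expCoeff_of_lt (show k + 1 < k + 2 by omega),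
      expCoeff_of_lt (show k + 1 < k + 2 + 1 by omega)] at hsum
    have hE : ∑ s ∈ Finset.range (k + 3), (downCoeff n (k + 2) * expCoeff n u v (k + 2) s +
        upCoeff n k * expCoeff n u v k s) * q s =
        u * v * ∑ s ∈ Finset.range (k + 3), expCoeff n u v (k + 1) s * q s +
        ∑ s ∈ Finset.range (k + 2 + 1), (downCoeff (n - 1) s * expCoeff n u v (k + 1) (s - 1) +
          upCoeff (n - 1) s * ((1 - u ^ 2) * (1 - v ^ 2)) * expCoeff n u v (k + 1) (s + 1)) *
            q s := by
      rw [Finset.mul_sum, ← Finset.sum_add_distrib]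
      refine Finset.sum_congr rfl fun s _ => ?_
      rw [← expCoeff_rec n k s hn u v]
      ring
    have hsplit : ∑ s ∈ Finset.range (k + 3), (downCoeff n (k + 2) * expCoeff n u v (k + 2) s +
        upCoeff n k * expCoeff n u v k s) * q s =
        downCoeff n (k + 2) * ∑ s ∈ Finset.range (k + 3), expCoeff n u v (k + 2) s * q s +
        upCoeff n k * ∑ s ∈ Finset.range (k + 3), expCoeff n u v k s * q s := by
      rw [Finset.mul_sum, Finset.mul_sum, ← Finset.sum_add_distrib]
      refine Finset.sum_congr rfl fun s _ => ?_
      ring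
    refine mul_left_cancel₀ hd ?_
    change _ = _ * ∑ s ∈ Finset.range (k + 3), expCoeff n u v (k + 2) s * q s
    linear_combination -hrec + hsplit - hE - hsum

/-! ### From real values to the polynomial identity -/

open MvPolynomial in
theorem eval_polynomial_aeval {σ R : Type*} [CommSemiring R] (y : σ → R)
    (q : MvPolynomial σ R) (p : Polynomial R) :
    eval y (Polynomial.aeval q p) = p.eval (eval y q) := by
  rw [Polynomial.aeval_def, Polynomial.hom_eval₂, algebraMap_eq, Polynomial.eval]
  congr 1
  ext r
  simp

open MvPolynomial in
/-- The addition formula as an identity of polynomials in `u`, `v`, `t`. -/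
theorem aeval_P_eq_sum_Y (n k : ℕ) (hn : 3 ≤ n) :
    Polynomial.aeval T (P n k) = ∑ s ∈ Finset.range (k + 1),
      C ((h (n - 1) s : ℝ) / (h n k : ℝ)) * Y n s (k - s) (k - s) := by
  -- A product of infinite sets determines a polynomial; on this cube the square root is positive
  -- and `Q_eval` applies.
  refine funext_set (fun _ => Set.Ioo (-1 : ℝ) 1) (fun _ => Set.Ioo_infinite (by norm_num))
    fun y hy => ?_
  obtain ⟨u, v, t, rfl⟩ : ∃ u v t, y = ![u, v, t] :=
    ⟨y 0, y 1, y 2, by ext i; fin_cases i <;> rfl⟩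
  have hu : u ^ 2 < 1 := by
    have := hy 0 trivial
    simp only [Matrix.cons_val, Set.mem_Ioo] at this
    nlinarith
  have hv : v ^ 2 < 1 := by
    have := hy 1 trivial
    simp only [Matrix.cons_val, Set.mem_Ioo] at this
    nlinarith
  have hw0 : 0 < (1 - u ^ 2) * (1 - v ^ 2) := mul_pos (by linarith) (by linarith)
  have hw := Real.sq_sqrt hw0.le
  have hwpos := Real.sqrt_pos.2 hw0
  have key := h_mul_P_eval_eq_sum n k hn u v _
    ((t - u * v) / Real.sqrt ((1 - u ^ 2) * (1 - v ^ 2))) hw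
  rw [mul_div_cancel₀ _ hwpos.ne', add_sub_cancel] at key
  have hh : (h n k : ℝ) ≠ 0 := by exact_mod_cast (h_pos n k (by omega)).ne'
  refine mul_left_cancel₀ hh ?_
  rw [eval_polynomial_aeval, map_sum, Finset.mul_sum]
  have hT : eval ![u, v, t] T = t := by simp [T]
  rw [hT, key]
  refine Finset.sum_congr rfl fun s hs => ?_
  have hU : eval ![u, v, t] U = u := by simp [U]
  have hV : eval ![u, v, t] V = v := by simp [V]
  rw [expCoeff, if_pos (Nat.lt_succ_iff.1 (Finset.mem_range.1 hs))]
  -- On the diagonal the square root in `lam` is the dimension itself.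
  simp only [Y, Matrix.of_apply, map_mul, eval_C, eval_polynomial_aeval, Q_eval _ _ u v t hu hv, hU, hV, lam,
    Real.sqrt_mul_self (Nat.cast_nonneg _), areaRatio]
  field_simp

/-! ### Positivity -/

theorem eval_aeval_T (n k : ℕ) (y : Fin 3 → ℝ) :
    MvPolynomial.eval y (Polynomial.aeval T (P n k)) = (P n k).eval (y 2) := by
  rw [eval_polynomial_aeval, T, MvPolynomial.eval_X]

theorem sum_P_eval_nonneg_of_Y (n : ℕ) (hn : 3 ≤ n) (C : Finset (EuclideanSpace ℝ (Fin n)))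
    (e : EuclideanSpace ℝ (Fin n)) (d : ℕ)
    (hY : ∀ k ≤ d, (∑ c ∈ C, ∑ c' ∈ C, corner (Y n k) (d - k)
      (inner ℝ e c) (inner ℝ e c') (inner ℝ c c')).PosSemidef) (k : ℕ) (hk : k ≤ d) :
    0 ≤ ∑ c ∈ C, ∑ c' ∈ C, (P n k).eval (inner ℝ c c') := by
  have hid : ∀ u v t : ℝ, (P n k).eval t = ∑ s ∈ Finset.range (k + 1),
      (h (n - 1) s : ℝ) / (h n k : ℝ) *
        MvPolynomial.eval ![u, v, t] (Y n s (k - s) (k - s)) := by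
    intro u v t
    have := congrArg (MvPolynomial.eval ![u, v, t]) (aeval_P_eq_sum_Y n k hn)
    rw [eval_aeval_T, map_sum] at this
    simpa using this
  have hswap : ∑ c ∈ C, ∑ c' ∈ C, (P n k).eval (inner ℝ c c') = ∑ s ∈ Finset.range (k + 1),
      (h (n - 1) s : ℝ) / (h n k : ℝ) * ∑ c ∈ C, ∑ c' ∈ C, MvPolynomial.eval
        ![inner ℝ e c, inner ℝ e c', inner ℝ c c'] (Y n s (k - s) (k - s)) := by
    simp_rw [Finset.mul_sum]
    rw [Finset.sum_comm (s := Finset.range (k + 1))]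
    refine Finset.sum_congr rfl fun c _ => ?_
    rw [Finset.sum_comm (s := Finset.range (k + 1))]
    exact Finset.sum_congr rfl fun c' _ => hid _ _ _
  rw [hswap]
  refine Finset.sum_nonneg fun s hs => mul_nonneg (by positivity) ?_
  have hsk : s ≤ k := Nat.lt_succ_iff.1 (Finset.mem_range.1 hs)
  -- Since `k ≤ d`, the entry `k - s` lies in the corner of size `d - s + 1`.
  have := (hY s (by omega)).diag_nonneg (i := ⟨k - s, by omega⟩)
  simpa [Matrix.sum_apply, corner] using this

theorem average_rename_aeval_P (n k : ℕ) (hn : 3 ≤ n) (y : Fin 3 → ℝ) :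
    (1 / 6 : ℝ) * ∑ σ : Equiv.Perm (Fin 3), (P n k).eval (y (σ 2)) =
      ∑ s ∈ Finset.range (k + 1), (h (n - 1) s : ℝ) / (h n k : ℝ) *
        MvPolynomial.eval y (S n s (k - s) (k - s)) := by
  have hσ : ∀ σ : Equiv.Perm (Fin 3), (P n k).eval (y (σ 2)) = ∑ s ∈ Finset.range (k + 1),
      (h (n - 1) s : ℝ) / (h n k : ℝ) *
        MvPolynomial.eval y (MvPolynomial.rename σ (Y n s (k - s) (k - s))) := by
    intro σ
    have := congrArg (MvPolynomial.eval (y ∘ σ)) (aeval_P_eq_sum_Y n k hn)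
    rw [eval_aeval_T, map_sum] at this
    simpa [MvPolynomial.eval_rename] using this
  simp_rw [hσ]
  rw [Finset.sum_comm, Finset.mul_sum]
  refine Finset.sum_congr rfl fun s _ => ?_
  rw [← Finset.mul_sum, S, Matrix.smul_apply, Matrix.sum_apply, MvPolynomial.smul_eval, map_sum]
  simp only [Matrix.map_apply]
  ring

/-- Each of the three inner products omits one point of the triple, so summing `P` of it over `C³`
gives `|C|` times the double sum. Averaging over permutations does not change this, and `|C| > 0`
can be divided out. -/
theorem sum_P_eval_nonneg_of_S (n : ℕ) (hn : 3 ≤ n) (C : Finset (EuclideanSpace ℝ (Fin n)))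
    (d : ℕ)
    (hS : ∀ k ≤ d, (∑ c ∈ C, ∑ c' ∈ C, ∑ c'' ∈ C, corner (S n k) (d - k)
      (inner ℝ c c') (inner ℝ c c'') (inner ℝ c' c'')).PosSemidef) (k : ℕ) (hk : k ≤ d) :
    0 ≤ ∑ c ∈ C, ∑ c' ∈ C, (P n k).eval (inner ℝ c c') := by
  rcases C.eq_empty_or_nonempty with rfl | hC
  · simp
  set G : ℝ := ∑ c ∈ C, ∑ c' ∈ C, (P n k).eval (inner ℝ c c') with hG
  have hi : ∀ i : Fin 3, ∑ c ∈ C, ∑ c' ∈ C, ∑ c'' ∈ C,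
      (P n k).eval ((![inner ℝ c c', inner ℝ c c'', inner ℝ c' c''] : Fin 3 → ℝ) i) =
        C.card * G := by
    intro i
    fin_cases i
    · simp [hG, Finset.mul_sum]
    · simp [hG, Finset.mul_sum]
    · simp [hG]
  have hswap : C.card * G = ∑ s ∈ Finset.range (k + 1),
      (h (n - 1) s : ℝ) / (h n k : ℝ) * ∑ c ∈ C, ∑ c' ∈ C, ∑ c'' ∈ C, MvPolynomial.eval
        ![inner ℝ c c', inner ℝ c c'', inner ℝ c' c''] (S n s (k - s) (k - s)) := by
    have h1 : C.card * G = (1 / 6 : ℝ) * ∑ σ : Equiv.Perm (Fin 3), ∑ c ∈ C, ∑ c' ∈ C, ∑ c'' ∈ C,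
        (P n k).eval ((![inner ℝ c c', inner ℝ c c'', inner ℝ c' c''] : Fin 3 → ℝ) (σ 2)) := by
      simp_rw [hi]
      rw [Finset.sum_const, Finset.card_univ, Fintype.card_perm, Fintype.card_fin]
      norm_num [Nat.factorial]
      ring
    rw [h1]
    simp_rw [Finset.mul_sum]
    rw [Finset.sum_comm, Finset.sum_comm (s := Finset.range (k + 1))]
    refine Finset.sum_congr rfl fun c _ => ?_
    rw [Finset.sum_comm, Finset.sum_comm (s := Finset.range (k + 1))]
    refine Finset.sum_congr rfl fun c' _ => ?_
    rw [Finset.sum_comm, Finset.sum_comm (s := Finset.range (k + 1))]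
    refine Finset.sum_congr rfl fun c'' _ => ?_
    rw [← average_rename_aeval_P n k hn, Finset.mul_sum]
  have hpos : 0 ≤ C.card * G := by
    rw [hswap]
    refine Finset.sum_nonneg fun s hs => mul_nonneg (by positivity) ?_
    have hsk : s ≤ k := Nat.lt_succ_iff.1 (Finset.mem_range.1 hs)
    have := (hS s (by omega)).diag_nonneg (i := ⟨k - s, by omega⟩)
    simpa [Matrix.sum_apply, corner] using this
  exact nonneg_of_mul_nonneg_right hpos (by exact_mod_cast hC.card_pos)

end SphereCode

theorem proposition3p6 (n : ℕ) (hn : 3 ≤ n) :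
    -- the expression of `P_k^n(t)`, an identity in `ℝ[u,v,t]`
    (∀ k : ℕ, Polynomial.aeval SphereCode.T (SphereCode.P n k) =
      ∑ s ∈ Finset.range (k + 1),
        MvPolynomial.C ((SphereCode.h (n - 1) s : ℝ) / (SphereCode.h n k : ℝ)) *
          SphereCode.Y n s (k - s) (k - s)) ∧
    -- positivity of the `Y_k^n` on a finite set implies classical positivity on that set
    (∀ C : Finset (EuclideanSpace ℝ (Fin n)), (∀ c ∈ C, ‖c‖ = 1) →
      ∀ e : EuclideanSpace ℝ (Fin n), ‖e‖ = 1 → ∀ d : ℕ,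
        (∀ k ≤ d, (∑ c ∈ C, ∑ c' ∈ C, SphereCode.corner (SphereCode.Y n k) (d - k)
          (inner ℝ e c) (inner ℝ e c') (inner ℝ c c')).PosSemidef) →
        ∀ k ≤ d, 0 ≤ ∑ c ∈ C, ∑ c' ∈ C, (SphereCode.P n k).eval (inner ℝ c c')) ∧
    -- positivity of the `S_k^n` on a finite set implies classical positivity on that set
    (∀ C : Finset (EuclideanSpace ℝ (Fin n)), (∀ c ∈ C, ‖c‖ = 1) → ∀ d : ℕ,
        (∀ k ≤ d, (∑ c ∈ C, ∑ c' ∈ C, ∑ c'' ∈ C, SphereCode.corner (SphereCode.S n k) (d - k)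
          (inner ℝ c c') (inner ℝ c c'') (inner ℝ c' c'')).PosSemidef) →
        ∀ k ≤ d, 0 ≤ ∑ c ∈ C, ∑ c' ∈ C, (SphereCode.P n k).eval (inner ℝ c c')) := by
  refine ⟨fun k => SphereCode.aeval_P_eq_sum_Y n k hn, fun C _ e _ d hY k hk => ?_,
    fun C _ d hS k hk => ?_⟩
  · exact SphereCode.sum_P_eval_nonneg_of_Y n hn C e d hY k hk
  · exact SphereCode.sum_P_eval_nonneg_of_S n hn C d hS k hk
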